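/- Let $M$ be a compact connected oriented surface and $\omega_0$ an Abelian differential on $M$ (a holomorphic $1$-form, not identically zero, for some complex structure on $M$). Let $SL(2,\mathbb R)$ act on Abelian differentials on $M$ by postcomposition of their local primitives. The Veech group $SL(M,\omega_0)\subset SL(2,\mathbb R)$ is the group of differentials of the orientation-preserving homeomorphisms of $M$ that preserve the zeros of $\omega_0$ and are affine in the translation charts of $\omega_0$ elsewhere. Assume that $(M,\omega_0)$ is a lattice surface, that is, $SL(M,\omega_0)$ is a lattice in $SL(2,\mathbb R)$. Let $\mathscr L_{\omega_0}$ be the $SL(2,\mathbb R)$-orbit of $(M,\omega_0)$ in the moduli space of Abelian differentials on $M$ up to homeomorphism, and let $\mu_0$ be the canonical measure on it: the image of the invariant probability measure of $SL(2,\mathbb R)/SL(M,\omega_0)$ under the bijection $g\,SL(M,\omega_0)\mapsto [g\cdot\omega_0]$. Let $\gamma\in H_1(M,\mathbb Z)$, $\gamma\ne 0$, and let $p:\widetilde M_\gamma\to M$ be the $\mathbb Z$-cover determined by $\gamma$: $\mathbb Z$ acts freely on $\widetilde M_\gamma$ by homeomorphisms, the orbits are the fibres of $p$, and every path from $x$ to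 $n\cdot x$ in $\widetilde M_\gamma$ projects to a loop $\sigma$ with intersection number $\langle\gamma,[\sigma]\rangle=n$. For an Abelian differential $\omega$ on $M$ let $\widetilde\omega_\gamma=p^*\omega$. For $\theta\in S^1=\mathbb R/2\pi\mathbb Z$ let $(\widetilde\varphi^\theta_t)_{t\in\mathbb R}$ be the directional flow on $(\widetilde M_\gamma,\widetilde\omega_\gamma)$, generated by the vector field $X_\theta$ with $\widetilde\omega_\gamma(X_\theta)=e^{i\theta}$, on the set of points whose orbit is defined for all times and avoids the zeros of $\widetilde\omega_\gamma$, with the invariant area measure $\mathrm{Re}\,\widetilde\omega_\gamma\wedge\mathrm{Im}\,\widetilde\omega_\gamma$. The vertical flow is the one with $\theta=\pi/2$. Consider the following properties of such a flow: - (P-1) it is not ergodic; - (P-2) it has uncountably many ergodic components, that is, in its ergodic decomposition (with respect to a probability measure equivalent to the area) no countable set of components has full measure; - (P-3) it has no invariant measurable set of positive finite measure. Let $i\in\{1,2,3\}$. Assume that for $\mu_0$-almost every point of $\mathscr L_{\omega_0}$, and for every $\omega\in SL(2,\mathbb R)\cdot\omega_0$ representing this point, the vertical flow on $(\widetilde M_\gamma,\widetilde\omega_\gamma)$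 satisfies (P-$i$). Then for Lebesgue-almost every $\theta\in S^1$ the directional flow $(\widetilde\varphi^\theta_t)_{t\in\mathbb R}$ on $(\widetilde M_\gamma,\widetilde{(\omega_0)}_\gamma)$ satisfies (P-$i$). -/

import Mathlib

open Filter Topology MeasureTheory
open scoped Simplicial ENNReal

noncomputable section

namespace FlatSurface

universe u v

/-! ### The group `SL(2, ℝ)` and its linear action on the plane -/

abbrev SL2R : Type := Matrix.SpecialLinearGroup (Fin 2) ℝ

instance : MeasurableSpace SL2R := borel SL2R

instance : BorelSpace SL2R := ⟨rfl⟩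

instance : LocallyCompactSpace SL2R :=
  have : LocallyCompactSpace (Matrix (Fin 2) (Fin 2) ℝ) :=
    inferInstanceAs (LocallyCompactSpace (Fin 2 → Fin 2 → ℝ))
  Matrix.SpecialLinearGroup.isClosedEmbedding_val.locallyCompactSpace

/-- The linear action of `SL(2, ℝ)` on `ℂ = ℝ²`. -/
def planeMap (g : SL2R) : ℂ →ₗ[ℝ] ℂ where
  toFun z := ⟨g 0 0 * z.re + g 0 1 * z.im, g 1 0 * z.re + g 1 1 * z.im⟩
  map_add' z w := by
    apply Complex.ext <;> simp <;> ring
  map_smul' r z := by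
    apply Complex.ext <;> simp <;> ring

theorem planeMap_one (z : ℂ) : planeMap 1 z = z := by
  apply Complex.ext <;> simp [planeMap]

theorem planeMap_mul (g h : SL2R) (z : ℂ) : planeMap (g * h) z = planeMap g (planeMap h z) := by
  apply Complex.ext <;>
    simp [planeMap, Matrix.mul_apply, Fin.sum_univ_two] <;> ring

/-- A real-linear area preserving map lifts to a homeomorphism through `z ↦ z ^ (k + 1)`. -/
theorem planeMap_lift (g : SL2R) (k : ℕ) :
    ∃ h : ℂ ≃ₜ ℂ, h 0 = 0 ∧ ∀ z, h z ^ (k + 1) = planeMap g (z ^ (k + 1)) := by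
  obtain ⟨a, b, hab, hL⟩ : ∃ a b : ℂ, ‖b‖ < ‖a‖ ∧
      ∀ z, planeMap g z = a * z + b * (starRingEnd ℂ) z := by
    refine ⟨⟨(g 0 0 + g 1 1) / 2, (g 1 0 - g 0 1) / 2⟩,
      ⟨(g 0 0 - g 1 1) / 2, (g 1 0 + g 0 1) / 2⟩, ?_, ?_⟩
    · have hdet := g.det_coe
      rw [Matrix.det_fin_two] at hdet
      have : ‖(⟨(g 0 0 - g 1 1) / 2, (g 1 0 + g 0 1) / 2⟩ : ℂ)‖ ^ 2 <
          ‖(⟨(g 0 0 + g 1 1) / 2, (g 1 0 - g 0 1) / 2⟩ : ℂ)‖ ^ 2 := by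
        rw [← Complex.normSq_eq_norm_sq, ← Complex.normSq_eq_norm_sq, Complex.normSq_mk,
          Complex.normSq_mk]
        nlinarith
      exact lt_of_pow_lt_pow_left₀ 2 (norm_nonneg _) this
    · intro z
      apply Complex.ext <;> simp [planeMap] <;> ring
  have ha : a ≠ 0 := by
    rintro rfl
    simp only [norm_zero] at hab
    exact absurd (norm_nonneg b) (not_le.mpr hab)
  set n := k + 1 with hn
  have hn0 : n ≠ 0 := by omega
  let u : ℂ → ℂ := fun z => 1 + b / a * ((starRingEnd ℂ) z / z) ^ n
  let h : ℂ → ℂ := fun z => z * (a ^ ((n : ℂ)⁻¹) * u z ^ ((n : ℂ)⁻¹))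
  have hpow : ∀ z, h z ^ n = planeMap g (z ^ n) := by
    intro z
    rcases eq_or_ne z 0 with rfl | hz
    · simp [h, hn0]
    · simp only [h, mul_pow, Complex.cpow_nat_inv_pow _ hn0, hL, u, map_pow, div_pow]
      field_simp
  have hu : ∀ z, u z ∈ Complex.slitPlane := by
    intro z
    apply Complex.mem_slitPlane_of_norm_lt_one
    rw [norm_mul, norm_pow, norm_div, norm_div, RCLike.norm_conj]
    have h1 : ‖b‖ / ‖a‖ < 1 := (div_lt_one (norm_pos_iff.mpr ha)).mpr hab
    have h2 : (‖z‖ / ‖z‖) ^ n ≤ 1 := pow_le_one₀ (by positivity) (div_self_le_one _)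
    calc _ ≤ ‖b‖ / ‖a‖ * 1 := by gcongr
      _ < 1 := by simpa using h1
  have hLc : Continuous (planeMap g) := LinearMap.continuous_of_finiteDimensional _
  have hginv : ∀ z, planeMap g⁻¹ (planeMap g z) = z := fun z => by
    rw [← planeMap_mul, inv_mul_cancel, planeMap_one]
  have hginv' : ∀ z, planeMap g (planeMap g⁻¹ z) = z := fun z => by
    rw [← planeMap_mul, mul_inv_cancel, planeMap_one]
  have hnorm : ∀ z, ‖h z‖ = ‖planeMap g (z ^ n)‖ ^ ((n : ℝ)⁻¹) := by
    intro z
    rw [← hpow, norm_pow, Real.pow_rpow_inv_natCast (norm_nonneg _) hn0]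
  have hnc : Continuous fun z => ‖h z‖ := by
    simp only [hnorm]
    refine Continuous.rpow_const (by fun_prop) fun z => Or.inr (by positivity)
  have hc : Continuous h := by
    rw [continuous_iff_continuousAt]
    intro z
    rcases eq_or_ne z 0 with rfl | hz
    · have h0 : h 0 = 0 := by simp [h]
      have := hnc.tendsto 0
      rw [h0, norm_zero] at this
      rw [ContinuousAt, h0]
      exact tendsto_zero_iff_norm_tendsto_zero.mpr this
    · have hcu : ContinuousAt u z := by
        refine continuousAt_const.add (continuousAt_const.mul ?_)
        exact ((Complex.continuous_conj.continuousAt).div continuousAt_id hz).pow n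
      exact continuousAt_id.mul (continuousAt_const.mul
        (hcu.cpow continuousAt_const (hu z)))
  have hinj : Function.Injective h := by
    intro z w hzw
    have h1 : z ^ n = w ^ n := by
      rw [← hginv (z ^ n), ← hpow, hzw, hpow, hginv]
    rcases eq_or_ne z 0 with rfl | hz
    · rw [zero_pow hn0] at h1
      exact (pow_eq_zero_iff hn0).mp h1.symm |>.symm
    have huu : u z = u w := by
      simp only [u, div_pow, ← map_pow, h1]
    have hne : a ^ ((n : ℂ)⁻¹) * u w ^ ((n : ℂ)⁻¹) ≠ 0 := by
      refine mul_ne_zero ?_ ?_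
      · intro h0
        have := Complex.cpow_nat_inv_pow a hn0
        rw [h0, zero_pow hn0] at this
        exact ha this.symm
      · intro h0
        have := Complex.cpow_nat_inv_pow (u w) hn0
        rw [h0, zero_pow hn0] at this
        exact Complex.slitPlane_ne_zero (hu w) this.symm
    simp only [h, huu] at hzw
    exact mul_right_cancel₀ hne hzw
  have hsurj : Function.Surjective h := by
    intro w
    rcases eq_or_ne w 0 with rfl | hw
    · exact ⟨0, by simp [h]⟩
    obtain ⟨z, hz⟩ := IsAlgClosed.exists_pow_nat_eq (planeMap g⁻¹ (w ^ n)) (Nat.pos_of_ne_zero hn0)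
    have h1 : h z ^ n = w ^ n := by rw [hpow, hz, hginv']
    have hz0 : h z ≠ 0 := by
      intro h0
      rw [h0, zero_pow hn0] at h1
      exact hw ((pow_eq_zero_iff hn0).mp h1.symm)
    set ζ := w / h z with hζ
    have hζ1 : ζ ^ n = 1 := by
      rw [hζ, div_pow, h1, div_self (pow_ne_zero _ hw)]
    have hzz : z ≠ 0 := by
      rintro rfl
      exact hz0 (by simp [h])
    have huz : u (ζ * z) = u z := by
      simp only [u, div_pow, ← map_pow, mul_pow, hζ1, one_mul]
    refine ⟨ζ * z, ?_⟩
    have : h (ζ * z) = ζ * h z := by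
      simp only [h, huz]; ring
    rw [this, hζ, div_mul_cancel₀ _ hz0]
  have hcoc : Tendsto h (cocompact ℂ) (cocompact ℂ) := by
    have h1 : Tendsto (fun z : ℂ => z ^ n) (cocompact ℂ) (cocompact ℂ) := by
      rw [← Metric.cobounded_eq_cocompact, ← comap_norm_atTop, tendsto_comap_iff]
      have : (norm ∘ fun z : ℂ => z ^ n) = (fun x : ℝ => x ^ n) ∘ norm := by
        ext z; simp
      rw [this]
      exact (tendsto_pow_atTop hn0).comp tendsto_comap
    have h2 : Tendsto (planeMap g) (cocompact ℂ) (cocompact ℂ) :=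
      (LinearMap.isClosedEmbedding_of_injective (LinearMap.ker_eq_bot.mpr
        (Function.LeftInverse.injective hginv))).tendsto_cocompact
    rw [← Metric.cobounded_eq_cocompact (α := ℂ), ← comap_norm_atTop, tendsto_comap_iff,
      comap_norm_atTop, Metric.cobounded_eq_cocompact]
    have : norm ∘ h = fun z => ‖planeMap g (z ^ n)‖ ^ ((n : ℝ)⁻¹) := funext hnorm
    rw [this]
    exact (tendsto_rpow_atTop (by positivity)).comp
      (tendsto_norm_cocompact_atTop.comp (h2.comp h1))
  have hclosed : IsClosedMap h := (isProperMap_iff_tendsto_cocompact.mpr ⟨hc, hcoc⟩).isClosedMap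
  exact ⟨(Equiv.ofBijective h ⟨hinj, hsurj⟩).toHomeomorphOfContinuousClosed hc hclosed,
    show h 0 = 0 by simp [h], hpow⟩

/-! ### Translation surfaces -/

/-- An Abelian differential `ω` on a topological surface `M` (not identically zero on any component),
together with the complex structure and the orientation that it determines. It is given by its local primitives: `prim x` is a function
defined near `x` with `d (prim x) = ω` (only its germ at `x`, up to an additive constant, matters).
Near each point `x` there is a topological chart `φ` (a holomorphic coordinate centred at `x` for
the complex structure of `ω`) in which the primitive is `z ^ (k + 1)`, where `k` is the order of
vanishing of `ω` at `x`. Two primitives differ locally by constants. -/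
structure AbelianDifferential (M : Type u) [TopologicalSpace M] where
  prim : M → M → ℂ
  local_form : ∀ x, ∃ (k : ℕ) (φ : OpenPartialHomeomorph M ℂ), x ∈ φ.source ∧ φ x = 0 ∧
    ∀ᶠ y in 𝓝 x, prim x y - prim x x = φ y ^ (k + 1)
  compatible : ∀ x, ∀ᶠ y in 𝓝 x, ∀ᶠ z in 𝓝 y, prim y z - prim y y = prim x z - prim x y

namespace AbelianDifferential

variable {M : Type u} [TopologicalSpace M] {N : Type v} [TopologicalSpace N]

/-- The pull-back of an Abelian differential by a local homeomorphism (such as a covering map). -/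
def pullback (ω : AbelianDifferential M) (p : N → M) (hp : IsLocalHomeomorph p) :
    AbelianDifferential N where
  prim x y := ω.prim (p x) (p y)
  local_form x := by
    obtain ⟨k, φ, hx, h0, h⟩ := ω.local_form (p x)
    obtain ⟨e, hxe, rfl⟩ := hp x
    exact ⟨k, e.trans φ, by simp [hxe, hx], by simpa using h0,
      by simpa using (hp.continuous.tendsto x).eventually h⟩
  compatible x := by
    filter_upwards [(hp.continuous.tendsto x).eventually (ω.compatible (p x))] with y hy
    exact (hp.continuous.tendsto y).eventually hy

/-- `SL(2, ℝ)` acts on Abelian differentials by postcomposition of the local primitives. -/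
instance : MulAction SL2R (AbelianDifferential M) where
  smul g ω :=
    { prim := fun x y => planeMap g (ω.prim x y)
      local_form := fun x => by
        obtain ⟨k, φ, hx, h0, h⟩ := ω.local_form x
        obtain ⟨l, hl0, hl⟩ := planeMap_lift g k
        refine ⟨k, φ.trans l.toOpenPartialHomeomorph, by simp [hx], by simp [h0, hl0], ?_⟩
        filter_upwards [h] with y hy
        rw [← map_sub, hy, ← hl]
        simp
      compatible := fun x => by
        filter_upwards [ω.compatible x] with y hy
        filter_upwards [hy] with z hz
        rw [← map_sub, ← map_sub, hz] }
  one_smul ω := by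
    cases ω
    simp [HSMul.hSMul, planeMap_one]
  mul_smul g h ω := by
    cases ω
    simp [HSMul.hSMul, planeMap_mul]

theorem smul_prim (g : SL2R) (ω : AbelianDifferential M) (x y : M) :
    (g • ω).prim x y = planeMap g (ω.prim x y) := rfl

/-- `f : (M, ω) → (N, η)` is an affine homeomorphism with differential `A`: in local primitives it
is `w ↦ A w + const`. (At the zeros this follows by continuity from the same relation at regular
points, and it forces `f` to map zeros of `ω` to zeros of `η`, preserving the orientation.) -/
def IsAffine (A : SL2R) (f : M ≃ₜ N) (ω : AbelianDifferential M) (η : AbelianDifferential N) :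
    Prop :=
  ∀ x, ∀ᶠ y in 𝓝 x,
    η.prim (f x) (f y) - η.prim (f x) (f x) = planeMap A (ω.prim x y - ω.prim x x)

theorem IsAffine.refl (ω : AbelianDifferential M) : IsAffine 1 (Homeomorph.refl M) ω ω :=
  fun x => Eventually.of_forall fun y => by simp [planeMap_one]

theorem IsAffine.trans {A B : SL2R} {f g : M ≃ₜ M} {ω η ζ : AbelianDifferential M}
    (hf : IsAffine A f ω η) (hg : IsAffine B g η ζ) : IsAffine (B * A) (f.trans g) ω ζ := by
  intro x
  filter_upwards [hf x, (f.continuous.tendsto x).eventually (hg (f x))] with y h1 h2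
  simp only [Homeomorph.trans_apply]
  rw [h2, h1, planeMap_mul]

theorem IsAffine.symm {A : SL2R} {f : M ≃ₜ M} {ω η : AbelianDifferential M}
    (hf : IsAffine A f ω η) : IsAffine A⁻¹ f.symm η ω := by
  intro x
  filter_upwards [(f.symm.continuous.tendsto x).eventually (hf (f.symm x))] with y h1
  rw [f.apply_symm_apply, f.apply_symm_apply] at h1
  rw [h1, ← planeMap_mul, inv_mul_cancel, planeMap_one]

theorem IsAffine.smul {A : SL2R} {f : M ≃ₜ M} {ω η : AbelianDifferential M}
    (hf : IsAffine A f ω η) (g h : SL2R) : IsAffine (h * A * g⁻¹) f (g • ω) (h • η) := by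
  intro x
  filter_upwards [hf x] with y h1
  simp only [smul_prim]
  rw [← map_sub, h1, ← map_sub, ← planeMap_mul, ← planeMap_mul, inv_mul_cancel_right]

/-- The Veech group `SL(M, ω)`: the differentials of the affine homeomorphisms of `(M, ω)`. -/
def veechGroup (ω : AbelianDifferential M) : Subgroup SL2R where
  carrier := {A | ∃ f : M ≃ₜ M, IsAffine A f ω ω}
  one_mem' := ⟨_, IsAffine.refl ω⟩
  mul_mem' := fun ⟨_, hf⟩ ⟨_, hg⟩ => ⟨_, hg.trans hf⟩
  inv_mem' := fun ⟨_, hf⟩ => ⟨_, hf.symm⟩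

/-! ### The moduli space and the `SL(2, ℝ)`-orbit -/

/-- Two Abelian differentials on `M` define the same point of the moduli space if one is the
pull-back of the other by a homeomorphism of `M`. -/
instance moduliSetoid (M : Type u) [TopologicalSpace M] : Setoid (AbelianDifferential M) where
  r ω η := ∃ f : M ≃ₜ M, IsAffine 1 f ω η
  iseqv :=
    { refl := fun ω => ⟨_, IsAffine.refl ω⟩
      symm := fun ⟨f, hf⟩ => ⟨f.symm, by simpa using hf.symm⟩
      trans := fun ⟨f, hf⟩ ⟨g, hg⟩ => ⟨f.trans g, by simpa using hf.trans hg⟩ }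

/-- The moduli space of Abelian differentials on `M`. -/
def ModuliSpace (M : Type u) [TopologicalSpace M] : Type u := Quotient (moduliSetoid M)

/-- The point of the moduli space defined by `ω`. -/
def moduliPoint (ω : AbelianDifferential M) : ModuliSpace M := Quotient.mk _ ω

/-- The map `g SL(M, ω₀) ↦ g • ω₀`, from `SL(2, ℝ) / SL(M, ω₀)` to the moduli space. It is
injective, and its image is the `SL(2, ℝ)`-orbit of `(M, ω₀)`. -/
def orbitMap (ω₀ : AbelianDifferential M) : SL2R ⧸ ω₀.veechGroup → ModuliSpace M :=
  Quotient.lift (fun g : SL2R => moduliPoint (g • ω₀)) (by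
    intro g h hgh
    obtain ⟨f, hf⟩ := QuotientGroup.leftRel_apply.mp hgh
    refine (Quotient.sound ⟨f, ?_⟩ : moduliPoint (h • ω₀) = moduliPoint (g • ω₀)).symm
    simpa using hf.smul h g)

/-- A subgroup of `SL(2, ℝ)` is a lattice if it is discrete and has finite covolume. -/
def IsLattice (Γ : Subgroup SL2R) : Prop :=
  DiscreteTopology Γ ∧
    ∃ F : Set SL2R, IsFundamentalDomain Γ.op F (Measure.haar : Measure SL2R) ∧
      (Measure.haar : Measure SL2R) F < ∞

/-- The invariant probability measure on `SL(2, ℝ) / Γ` induced by Haar measure: the image of the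
normalized Haar measure on a fundamental domain (it does not depend on the domain). -/
def quotientHaar {Γ : Subgroup SL2R} (hΓ : IsLattice Γ) : Measure (SL2R ⧸ Γ) :=
  Measure.map (QuotientGroup.mk : SL2R → SL2R ⧸ Γ)
    (ProbabilityTheory.cond Measure.haar hΓ.2.choose)

/-- `(M, ω)` is a lattice surface if its Veech group is a lattice. -/
def IsLatticeSurface (ω : AbelianDifferential M) : Prop := IsLattice ω.veechGroup

/-- The σ-algebra on the moduli space whose trace on the orbit of `ω₀` is the Borel σ-algebra of
`SL(2, ℝ) / SL(M, ω₀)`, transported by `orbitMap`. -/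
@[reducible]
def orbitMeasurableSpace (ω₀ : AbelianDifferential M) : MeasurableSpace (ModuliSpace M) :=
  MeasurableSpace.map ω₀.orbitMap inferInstance

/-- The canonical measure on the orbit of a lattice surface: the image of the invariant measure
of `SL(2, ℝ) / SL(M, ω₀)` by `orbitMap`. -/
def canonicalMeasure (ω₀ : AbelianDifferential M) (h : ω₀.IsLatticeSurface) :
    @Measure (ModuliSpace M) ω₀.orbitMeasurableSpace :=
  @Measure.map _ _ _ ω₀.orbitMeasurableSpace ω₀.orbitMap (quotientHaar h)

/-! ### The area measure and the directional flows -/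

/-- `e` is a translation chart: it is a local primitive of `ω` on its domain. -/
def IsTranslationChart (ω : AbelianDifferential M) (e : OpenPartialHomeomorph M ℂ) : Prop :=
  ∀ x ∈ e.source, ∀ᶠ y in 𝓝 x, e y - e x = ω.prim x y - ω.prim x x

/-- The zeros of `ω`: the points which are in no translation chart. -/
def zeros (ω : AbelianDifferential M) : Set M :=
  {x | ∀ e : OpenPartialHomeomorph M ℂ, ω.IsTranslationChart e → x ∉ e.source}

/-- The area measure `ν_ω = Re ω ∧ Im ω`, as the least measure which restricts to (at least, hence
exactly) Lebesgue measure in each translation chart. -/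
def area (ω : AbelianDifferential M) [MeasurableSpace M] : Measure M :=
  ⨆ (e : OpenPartialHomeomorph M ℂ) (_ : ω.IsTranslationChart e),
    Measure.map e.symm (volume.restrict e.target)

instance : Fact (0 < 2 * Real.pi) := ⟨Real.two_pi_pos⟩

/-- The unit vector `e^{iθ}`, for `θ` in the circle `S¹ = ℝ / 2πℤ`. -/
def dir (θ : AddCircle (2 * Real.pi)) : ℂ := (AddCircle.toCircle θ : ℂ)

/-- The vertical direction `π / 2`. -/
def vertical : AddCircle (2 * Real.pi) := ((Real.pi / 2 : ℝ) : AddCircle (2 * Real.pi))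

/-- `c` is a complete trajectory of the directional flow of `ω` in direction `θ`: it avoids the
zeros and moves with constant velocity `e^{iθ}` in local primitives. -/
def IsTrajectory (ω : AbelianDifferential M) (θ : AddCircle (2 * Real.pi)) (c : ℝ → M) : Prop :=
  Continuous c ∧ (∀ t, c t ∉ ω.zeros) ∧
    ∀ t, ∀ᶠ s in 𝓝 t, ω.prim (c t) (c s) - ω.prim (c t) (c t) = ((s - t : ℝ) : ℂ) * dir θ

end AbelianDifferential

/-! ### Ergodic theory of flows -/

/-- The data of a flow `(φ_t)` defined on a subset of a measure space. -/
structure FlowSystem (X : Type u) [MeasurableSpace X] where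
  domain : Set X
  flow : ℝ → X → X
  measure : Measure X

open Classical in
/-- The directional flow of `ω` in direction `θ`, on the set of the points whose trajectory is
defined for all times, with the area measure. (Trajectories are unique if `M` is Hausdorff.) -/
def AbelianDifferential.directionalFlow {M : Type u} [TopologicalSpace M] [MeasurableSpace M]
    (ω : AbelianDifferential M) (θ : AddCircle (2 * Real.pi)) : FlowSystem M where
  domain := {x | ∃ c, ω.IsTrajectory θ c ∧ c 0 = x}
  flow t x := if h : ∃ c, ω.IsTrajectory θ c ∧ c 0 = x then h.choose t else x
  measure := ω.area

namespace FlowSystem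

variable {X : Type u} [MeasurableSpace X]

/-- The σ-algebra of the measurable sets invariant under the flow. -/
@[reducible]
def invariantSets (S : FlowSystem X) : MeasurableSpace X where
  MeasurableSet' A := MeasurableSet A ∧ ∀ x ∈ S.domain, ∀ t, S.flow t x ∈ A ↔ x ∈ A
  measurableSet_empty := ⟨MeasurableSet.empty, by simp⟩
  measurableSet_compl A hA := ⟨hA.1.compl, fun x hx t => not_congr (hA.2 x hx t)⟩
  measurableSet_iUnion A hA := ⟨MeasurableSet.iUnion fun i => (hA i).1, fun x hx t => by
    simp only [Set.mem_iUnion, (hA _).2 x hx t]⟩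

/-- `A` is a measurable invariant set. -/
def IsInvariant (S : FlowSystem X) (A : Set X) : Prop := MeasurableSet[S.invariantSets] A

/-- The flow is ergodic with respect to `m`. -/
def IsErgodicFor (S : FlowSystem X) (m : Measure X) : Prop :=
  ∀ A, S.IsInvariant A → m A = 0 ∨ m Aᶜ = 0

/-- The flow is ergodic. -/
def IsErgodic (S : FlowSystem X) : Prop := S.IsErgodicFor S.measure

/-- The flow preserves the measure `m`. -/
def Preserves (S : FlowSystem X) (m : Measure X) : Prop :=
  m S.domainᶜ = 0 ∧
    ∀ t A, MeasurableSet A → m {x | x ∈ S.domain ∧ S.flow t x ∈ A} = m A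

/-- `κ` is the ergodic decomposition of the flow with respect to the probability measure `m`: the
disintegration of `m` over the σ-algebra of invariant sets, into ergodic measures equivalent to
σ-finite invariant measures. The space of ergodic components is the quotient of `X` by the
σ-algebra of invariant sets, and `κ x` represents the component of `x`. -/
structure IsErgodicDecomposition (S : FlowSystem X) (m : Measure X) (κ : X → Measure X) :
    Prop where
  isProbabilityMeasure : ∀ x, IsProbabilityMeasure (κ x)
  measurable : ∀ A, MeasurableSet A → Measurable[S.invariantSets] fun x => κ x A
  disintegration : ∀ A B, MeasurableSet A → S.IsInvariant B → m (A ∩ B) = ∫⁻ x in B, κ x A ∂m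
  ergodic : ∀ᵐ x ∂m, S.IsErgodicFor (κ x)
  equivalent_invariant : ∀ᵐ x ∂m, ∃ μ : Measure X, SigmaFinite μ ∧ S.Preserves μ ∧
    κ x ≪ μ ∧ μ ≪ κ x

/-- The flow has uncountably many ergodic components: for a probability measure `m` equivalent to
the measure of the system and its ergodic decomposition, no countable family of components has
full measure. -/
def HasUncountablyManyErgodicComponents (S : FlowSystem X) : Prop :=
  ∃ (m : Measure X) (κ : X → Measure X), IsProbabilityMeasure m ∧ m ≪ S.measure ∧
    S.measure ≪ m ∧ S.IsErgodicDecomposition m κ ∧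
    ∀ C : Set (Measure X), C.Countable → ¬ ∀ᵐ x ∂m, κ x ∈ C

/-- No invariant set has positive finite measure. -/
def HasNoFiniteInvariantSets (S : FlowSystem X) : Prop :=
  ∀ A, S.IsInvariant A → S.measure A = 0 ∨ S.measure A = ∞

end FlowSystem

/-! ### Homology, the intersection form and `ℤ`-covers -/

section Homology

open CategoryTheory

/-- The coefficient group `ℤ`. -/
abbrev coeffZ : ModuleCat.{u} ℤ := ModuleCat.of ℤ (ULift.{u} ℤ)

/-- The singular simplicial set of `M`. -/
abbrev sing (M : Type u) [TopologicalSpace M] : SSet.{u} := TopCat.toSSet.obj (TopCat.of M)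

/-- The singular chain complex of `M`, with integer coefficients. -/
abbrev chains (M : Type u) [TopologicalSpace M] : ChainComplex (ModuleCat.{u} ℤ) ℕ :=
  ((AlgebraicTopology.singularChainComplexFunctor (ModuleCat.{u} ℤ)).obj coeffZ).obj (TopCat.of M)

/-- Singular homology `H_n(M, ℤ)`. -/
abbrev H (n : ℕ) (M : Type u) [TopologicalSpace M] : ModuleCat.{u} ℤ :=
  ((AlgebraicTopology.singularHomologyFunctor (ModuleCat.{u} ℤ) n).obj coeffZ).obj (TopCat.of M)

variable {M : Type u} [TopologicalSpace M]

/-- The class `a` is represented by the chain `z`. -/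
def Represents (n : ℕ) (z : (chains M).X n) (a : H n M) : Prop :=
  ∃ w : (chains M).cycles n,
    ((chains M).iCycles n).hom w = z ∧ ((chains M).homologyπ n).hom w = a

/-- `c` is a singular `1`-cocycle. -/
def IsCocycle (c : sing M _⦋1⦌ → ℤ) : Prop :=
  ∀ s : sing M _⦋2⦌,
    c ((sing M).δ 0 s) - c ((sing M).δ 1 s) + c ((sing M).δ 2 s) = 0

/-- Cap product of `2`-chains with a `1`-cochain: `c` is evaluated on the front face
`[e₀, e₁]`, and the back face `[e₁, e₂]` is kept. -/
def cap (c : sing M _⦋1⦌ → ℤ) : (chains M).X 2 ⟶ (chains M).X 1 :=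
  Limits.Sigma.desc fun s : sing M _⦋2⦌ =>
    c ((sing M).δ 2 s) • (sing M).ιChainComplex ((sing M).δ 0 s)

/-- Evaluation of the cup product `c ∪ d` of `1`-cochains on `2`-chains. -/
def cup (c d : sing M _⦋1⦌ → ℤ) : (chains M).X 2 ⟶ coeffZ :=
  Limits.Sigma.desc fun s : sing M _⦋2⦌ =>
    (c ((sing M).δ 2 s) * d ((sing M).δ 0 s)) • 𝟙 coeffZ

/-- `o` is an orientation (fundamental) class of the closed connected surface `M`: a generator of
the infinite cyclic group `H₂(M, ℤ)`. Both orientations are allowed; replacing `o` by `-o` only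
replaces the action of `ℤ` on the covers below by its inverse. -/
def IsFundamentalClass (o : H 2 M) : Prop := Function.Bijective fun n : ℤ => n • o

/-- The intersection number of `a, b ∈ H₁(M, ℤ)`, for the orientation `o`, is `n`. Writing
`a = c ∩ o` and `b = d ∩ o` (Poincaré duality) it is `(c ∪ d)(o)`. -/
def IsIntersectionNumber (o : H 2 M) (a b : H 1 M) (n : ℤ) : Prop :=
  ∃ (z : (chains M).X 2) (c d : sing M _⦋1⦌ → ℤ), Represents 2 z o ∧ IsCocycle c ∧ IsCocycle d ∧
    Represents 1 ((cap c).hom z) a ∧ Represents 1 ((cap d).hom z) b ∧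
    ((cup c d).hom z).down = n

/-- A path, as a singular `1`-simplex. -/
def pathSimplex (σ : C(unitInterval, M)) : sing M _⦋1⦌ :=
  ((TopCat.of M).toSSetObjEquiv (Opposite.op ⦋1⦌)).symm
    (σ.comp ⟨fun x => ⟨x.1 (1 : Fin 2), mem_Icc_of_mem_stdSimplex x.2 _⟩,
      Continuous.subtype_mk ((continuous_apply _).comp continuous_subtype_val) _⟩)

/-- The homology class of the loop `σ` is `a`. -/
def IsLoopClass (σ : C(unitInterval, M)) (a : H 1 M) : Prop :=
  Represents 1 (((sing M).ιChainComplex (R := coeffZ) (pathSimplex σ)).hom (ULift.up 1)) a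

/-- `p : N → M`, with the given action of `ℤ` on `N`, is the `ℤ`-cover `M̃_γ` of `M` determined by
`γ ∈ H₁(M, ℤ)`: a covering map whose fibres are the orbits of a free action of `ℤ` by
homeomorphisms, such that a path in `N` from `x` to `n +ᵥ x` projects to a loop whose homology
class has intersection number `n` with `γ`. This determines the cover up to isomorphism. -/
structure IsZCover (o : H 2 M) (γ : H 1 M) {N : Type v} [TopologicalSpace N] [AddAction ℤ N]
    (p : N → M) : Prop where
  isCoveringMap : IsCoveringMap p
  surjective : Function.Surjective p
  continuous_vadd : ∀ n : ℤ, Continuous fun x : N => n +ᵥ x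
  free : ∀ (n : ℤ) (x : N), n +ᵥ x = x → n = 0
  fibre : ∀ x y : N, p x = p y ↔ ∃ n : ℤ, n +ᵥ x = y
  monodromy : ∀ (v : C(unitInterval, N)) (n : ℤ), v 1 = n +ᵥ v 0 →
    ∃ a : H 1 M, IsLoopClass ⟨fun t => p (v t), isCoveringMap.continuous.comp v.continuous⟩ a ∧
      IsIntersectionNumber o γ a n

/-- The pull-back of `ω` to the `ℤ`-cover. -/
def IsZCover.lift {o : H 2 M} {γ : H 1 M} {N : Type v} [TopologicalSpace N] [AddAction ℤ N]
    {p : N → M} (hp : IsZCover o γ p) (ω : AbelianDifferential M) : AbelianDifferential N :=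
  ω.pullback p hp.isCoveringMap.isLocalHomeomorph

end Homology

end FlatSurface

end

/-! The argument transfers the vertical flow of `g • ω₀` to a directional flow of `ω₀`, and then uses
Fubini's theorem on `SL(2, ℝ) × S¹`.

If the linear map `g` sends `e^{iθ}` to a non-zero real multiple `τ i` of the vertical direction,
then the trajectories of `g • ω` in the vertical direction are those of `ω` in direction `θ`,
reparametrized by the factor `τ⁻¹` (`directionalFlow_smul_isTimeChange`). The zeros are the same, and
so is the area because `det g = 1` (`area_smul`). Each of the three properties is insensitive to such
a constant time change (`FlowSystem.IsTimeChange`). All this applies to the cover, since pulling back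
commutes with the action of `SL(2, ℝ)`.

The property assumed at almost every point of the orbit is a property of cosets `g SL(M, ω₀)`.
Since the Veech group is countable, it holds for Haar-almost every `g`, and not only on a
fundamental domain (`ae_haar_of_ae_canonicalMeasure`). Right translation by the rotation `r_φ`
preserves Haar-null sets, so by Fubini there is a `g` such that the property holds for
`(g r_φ) • ω₀` for almost every `φ`. If `g` sends direction `α` to the vertical one, this is the
property of the flow of `ω₀` in direction `α - φ`, and `φ ↦ α - φ` preserves Lebesgue measure on the
circle. The set of good directions is not assumed measurable: Fubini is applied to a measurable null
set which contains the exceptional elements of `SL(2, ℝ)`. -/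

open Filter Topology MeasureTheory
open scoped ENNReal

noncomputable section

namespace FlatSurface

universe u v

/-! ### Constant time changes of flows -/

namespace FlowSystem

variable {X : Type u} [MeasurableSpace X]

/-- `S'` is the flow `S` run at constant speed `τ`. -/
structure IsTimeChange (S S' : FlowSystem X) (τ : ℝ) : Prop where
  domain_eq : S'.domain = S.domain
  measure_eq : S'.measure = S.measure
  flow_eq : ∀ x ∈ S.domain, ∀ t, S'.flow t x = S.flow (τ * t) x

namespace IsTimeChange

variable {S S' : FlowSystem X} {τ : ℝ}

theorem invariantSets_eq (h : S.IsTimeChange S' τ) (hτ : τ ≠ 0) :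
    S'.invariantSets = S.invariantSets := by
  refine MeasurableSpace.ext fun A => and_congr_right fun _ => ?_
  rw [h.domain_eq]
  refine forall₂_congr fun x hx => ⟨fun H t => ?_, fun H t => ?_⟩
  · have := H (τ⁻¹ * t)
    rwa [h.flow_eq x hx, mul_inv_cancel_left₀ hτ] at this
  · rw [h.flow_eq x hx, H]

theorem isInvariant_iff (h : S.IsTimeChange S' τ) (hτ : τ ≠ 0) {A : Set X} :
    S'.IsInvariant A ↔ S.IsInvariant A := by
  rw [IsInvariant, IsInvariant, h.invariantSets_eq hτ]

theorem isErgodicFor_iff (h : S.IsTimeChange S' τ) (hτ : τ ≠ 0) (m : Measure X) :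
    S'.IsErgodicFor m ↔ S.IsErgodicFor m := by
  simp only [IsErgodicFor, h.isInvariant_iff hτ]

theorem isErgodic_iff (h : S.IsTimeChange S' τ) (hτ : τ ≠ 0) : S'.IsErgodic ↔ S.IsErgodic := by
  rw [IsErgodic, IsErgodic, h.isErgodicFor_iff hτ, h.measure_eq]

theorem hasNoFiniteInvariantSets_iff (h : S.IsTimeChange S' τ) (hτ : τ ≠ 0) :
    S'.HasNoFiniteInvariantSets ↔ S.HasNoFiniteInvariantSets := by
  simp only [HasNoFiniteInvariantSets, h.isInvariant_iff hτ, h.measure_eq]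

theorem preserves_iff (h : S.IsTimeChange S' τ) (hτ : τ ≠ 0) (m : Measure X) :
    S'.Preserves m ↔ S.Preserves m := by
  have key : ∀ (t : ℝ) (A : Set X), {x | x ∈ S'.domain ∧ S'.flow t x ∈ A} =
      {x | x ∈ S.domain ∧ S.flow (τ * t) x ∈ A} := by
    intro t A
    ext x
    simp only [Set.mem_ofPred_eq, h.domain_eq]
    exact and_congr_right fun hx => by rw [h.flow_eq x hx]
  simp only [Preserves, key]
  rw [h.domain_eq]
  refine and_congr_right fun _ => ⟨fun H t A hA => ?_, fun H t A hA => H _ A hA⟩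
  simpa only [mul_inv_cancel_left₀ hτ] using H (τ⁻¹ * t) A hA

theorem isErgodicDecomposition_iff (h : S.IsTimeChange S' τ) (hτ : τ ≠ 0) (m : Measure X)
    (κ : X → Measure X) : S'.IsErgodicDecomposition m κ ↔ S.IsErgodicDecomposition m κ := by
  constructor
  · rintro ⟨h1, h2, h3, h4, h5⟩
    rw [h.invariantSets_eq hτ] at h2
    simp only [h.isInvariant_iff hτ, h.isErgodicFor_iff hτ, h.preserves_iff hτ] at h3 h4 h5
    exact ⟨h1, h2, h3, h4, h5⟩
  · rintro ⟨h1, h2, h3, h4, h5⟩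
    rw [← h.invariantSets_eq hτ] at h2
    simp only [← h.isInvariant_iff hτ, ← h.isErgodicFor_iff hτ, ← h.preserves_iff hτ] at h3 h4 h5
    exact ⟨h1, h2, h3, h4, h5⟩

theorem hasUncountablyManyErgodicComponents_iff (h : S.IsTimeChange S' τ) (hτ : τ ≠ 0) :
    S'.HasUncountablyManyErgodicComponents ↔ S.HasUncountablyManyErgodicComponents := by
  simp only [HasUncountablyManyErgodicComponents, h.isErgodicDecomposition_iff hτ, h.measure_eq]

end IsTimeChange

end FlowSystem

/-! ### The linear action on the plane -/

theorem planeMap_inv_apply (g : SL2R) (z : ℂ) : planeMap g⁻¹ (planeMap g z) = z := by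
  rw [← planeMap_mul, inv_mul_cancel, planeMap_one]

theorem planeMap_apply_inv (g : SL2R) (z : ℂ) : planeMap g (planeMap g⁻¹ z) = z := by
  rw [← planeMap_mul, mul_inv_cancel, planeMap_one]

theorem planeMap_ofReal_mul (g : SL2R) (r : ℝ) (z : ℂ) :
    planeMap g (r * z) = r * planeMap g z := by
  simpa [Complex.real_smul] using (planeMap g).map_smul r z

/-- `planeMap g` as a homeomorphism. -/
def planeHomeo (g : SL2R) : ℂ ≃ₜ ℂ where
  toFun := planeMap g
  invFun := planeMap g⁻¹
  left_inv := planeMap_inv_apply g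
  right_inv := planeMap_apply_inv g
  continuous_toFun := LinearMap.continuous_of_finiteDimensional _
  continuous_invFun := LinearMap.continuous_of_finiteDimensional _

theorem det_planeMap (g : SL2R) : LinearMap.det (planeMap g) = 1 := by
  rw [← LinearMap.det_toMatrix Complex.basisOneI, ← g.det_coe, Matrix.det_fin_two,
    Matrix.det_fin_two]
  simp [LinearMap.toMatrix_apply, planeMap]

theorem measurePreserving_planeMap (g : SL2R) : MeasurePreserving (planeMap g) := by
  refine ⟨(planeHomeo g).continuous.measurable, ?_⟩
  rw [Measure.map_linearMap_addHaar_eq_smul_addHaar] <;> simp [det_planeMap]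

/-! ### The action on Abelian differentials, their zeros, area and trajectories -/

namespace AbelianDifferential

variable {M : Type u} [TopologicalSpace M]

theorem IsTranslationChart.smul {ω : AbelianDifferential M} {e : OpenPartialHomeomorph M ℂ}
    (he : ω.IsTranslationChart e) (g : SL2R) :
    (g • ω).IsTranslationChart (e.trans (planeHomeo g).toOpenPartialHomeomorph) := by
  intro x hx
  filter_upwards [he x (by simpa using hx)] with y hy
  rw [smul_prim, smul_prim, ← map_sub, ← hy, map_sub]
  rfl

theorem zeros_smul_subset (g : SL2R) (ω : AbelianDifferential M) : (g • ω).zeros ⊆ ω.zeros :=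
  fun _ hx e he hxe => hx _ (he.smul g) (by simpa using hxe)

theorem zeros_smul (g : SL2R) (ω : AbelianDifferential M) : (g • ω).zeros = ω.zeros :=
  (zeros_smul_subset g ω).antisymm (by simpa using zeros_smul_subset g⁻¹ (g • ω))

theorem map_symm_trans_planeHomeo [MeasurableSpace M] [BorelSpace M]
    (e : OpenPartialHomeomorph M ℂ) (g : SL2R) :
    Measure.map (e.trans (planeHomeo g).toOpenPartialHomeomorph).symm
      (volume.restrict (e.trans (planeHomeo g).toOpenPartialHomeomorph).target) =
    Measure.map e.symm (volume.restrict e.target) := by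
  have hmp : MeasurePreserving (planeMap g⁻¹) (volume.restrict (planeMap g⁻¹ ⁻¹' e.target))
      (volume.restrict e.target) :=
    (measurePreserving_planeMap g⁻¹).restrict_preimage e.open_target.measurableSet
  have ht : (e.trans (planeHomeo g).toOpenPartialHomeomorph).target =
      planeMap g⁻¹ ⁻¹' e.target := by
    ext z
    simp [planeHomeo]
  rw [ht]
  have hm : AEMeasurable e.symm (Measure.map (planeMap g⁻¹)
      (volume.restrict (planeMap g⁻¹ ⁻¹' e.target))) := by
    rw [hmp.map_eq]
    exact e.continuousOn_symm.aemeasurable e.open_target.measurableSet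
  conv_rhs => rw [← hmp.map_eq, AEMeasurable.map_map_of_aemeasurable hm hmp.measurable.aemeasurable]
  rfl

theorem area_le_area_smul [MeasurableSpace M] [BorelSpace M] (g : SL2R)
    (ω : AbelianDifferential M) : ω.area ≤ (g • ω).area := by
  refine iSup₂_le fun e he => ?_
  rw [← map_symm_trans_planeHomeo e g]
  exact le_iSup₂_of_le _ (he.smul g) le_rfl

theorem area_smul [MeasurableSpace M] [BorelSpace M] (g : SL2R) (ω : AbelianDifferential M) :
    (g • ω).area = ω.area :=
  (by simpa using area_le_area_smul g⁻¹ (g • ω) : (g • ω).area ≤ ω.area).antisymm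
    (area_le_area_smul g ω)

/-- Two trajectories agree on a closed set of times, as `M` is Hausdorff, and this set is open, as
a translation chart is injective and sends both to the same straight line. -/
theorem IsTrajectory.unique [T2Space M] {ω : AbelianDifferential M}
    {θ : AddCircle (2 * Real.pi)} {c d : ℝ → M} (hc : ω.IsTrajectory θ c)
    (hd : ω.IsTrajectory θ d) (h0 : c 0 = d 0) : c = d := by
  have hclopen : IsClopen {t | c t = d t} := by
    refine ⟨isClosed_eq hc.1 hd.1, isOpen_iff_mem_nhds.mpr fun t ht => ?_⟩
    have ht' : c t = d t := ht
    obtain ⟨e, he, hte⟩ : ∃ e : OpenPartialHomeomorph M ℂ,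
        ω.IsTranslationChart e ∧ c t ∈ e.source := by
      simpa [zeros] using hc.2.1 t
    have hce := hc.1.tendsto t
    have hde := hd.1.tendsto t
    rw [← ht'] at hde
    have hd2 := hd.2.2 t
    rw [← ht'] at hd2
    have hs := e.open_source.mem_nhds hte
    filter_upwards [hce.eventually (he _ hte), hde.eventually (he _ hte), hc.2.2 t, hd2,
      hce.eventually hs, hde.eventually hs] with s h1 h2 h3 h4 h5 h6
    refine e.injOn h5 h6 ?_
    rw [h3, ← h4, ← h2] at h1
    exact sub_left_injective h1
  have := hclopen.eq_univ ⟨0, h0⟩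
  exact funext fun t => (this ▸ Set.mem_univ t : t ∈ {t | c t = d t})

theorem IsTrajectory.smul {ω : AbelianDifferential M} {θ θ' : AddCircle (2 * Real.pi)} {c : ℝ → M}
    (hc : ω.IsTrajectory θ c) {g : SL2R} {τ : ℝ} (hτ : τ ≠ 0)
    (hg : planeMap g (dir θ) = τ * dir θ') :
    (g • ω).IsTrajectory θ' fun t => c (τ⁻¹ * t) := by
  refine ⟨hc.1.comp (by fun_prop), fun t => by rw [zeros_smul]; exact hc.2.1 _, fun t => ?_⟩
  have hlim : Tendsto (fun s : ℝ => τ⁻¹ * s) (𝓝 t) (𝓝 (τ⁻¹ * t)) :=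
    Continuous.tendsto (by fun_prop) t
  filter_upwards [hlim.eventually (hc.2.2 (τ⁻¹ * t))] with s hs
  rw [smul_prim, smul_prim, ← map_sub, hs, planeMap_ofReal_mul, hg, ← mul_assoc, ← mul_sub,
    ← Complex.ofReal_mul, mul_right_comm, inv_mul_cancel₀ hτ, one_mul]

/-- The flow is defined by a choice of trajectories; by uniqueness any trajectory computes it. -/
theorem directionalFlow_flow_eq [T2Space M] [MeasurableSpace M] {ω : AbelianDifferential M}
    {θ : AddCircle (2 * Real.pi)} {c : ℝ → M} (hc : ω.IsTrajectory θ c) (t : ℝ) :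
    (ω.directionalFlow θ).flow t (c 0) = c t := by
  have h : ∃ d, ω.IsTrajectory θ d ∧ d 0 = c 0 := ⟨c, hc, rfl⟩
  have := h.choose_spec.1.unique hc h.choose_spec.2
  simp only [directionalFlow, dif_pos h]
  rw [this]

/-- If `g` maps the direction `θ` to `θ'`, stretching it by `τ`, then the flow of `g • ω` in
direction `θ'` is the flow of `ω` in direction `θ` at speed `τ⁻¹`. -/
theorem directionalFlow_smul_isTimeChange [T2Space M] [MeasurableSpace M] [BorelSpace M]
    (ω : AbelianDifferential M) {θ θ' : AddCircle (2 * Real.pi)} {g : SL2R} {τ : ℝ} (hτ : τ ≠ 0)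
    (hg : planeMap g (dir θ) = τ * dir θ') :
    (ω.directionalFlow θ).IsTimeChange ((g • ω).directionalFlow θ') τ⁻¹ where
  domain_eq := by
    have hg' : planeMap g⁻¹ (dir θ') = (τ⁻¹ : ℝ) * dir θ := by
      rw [← planeMap_inv_apply g (dir θ), hg, planeMap_ofReal_mul, ← mul_assoc,
        ← Complex.ofReal_mul, inv_mul_cancel₀ hτ, Complex.ofReal_one, one_mul]
    ext x
    constructor
    · rintro ⟨c, hc, rfl⟩
      have h := hc.smul (inv_ne_zero hτ) hg'
      rw [inv_smul_smul] at h
      exact ⟨_, h, by simp⟩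
    · rintro ⟨c, hc, rfl⟩
      exact ⟨_, hc.smul hτ hg, by simp⟩
  measure_eq := area_smul g ω
  flow_eq := by
    rintro x ⟨c, hc, rfl⟩ t
    have h := directionalFlow_flow_eq (hc.smul hτ hg) t
    rw [mul_zero] at h
    rw [h, directionalFlow_flow_eq hc]

end AbelianDifferential

/-! ### Rotations and directions -/

open AbelianDifferential

theorem dir_re_sq_add_im_sq (φ : AddCircle (2 * Real.pi)) :
    (dir φ).re * (dir φ).re + (dir φ).im * (dir φ).im = 1 := by
  rw [← Complex.normSq_apply]
  exact Circle.normSq_coe _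

/-- The rotation of angle `φ`. -/
def rotation (φ : AddCircle (2 * Real.pi)) : SL2R :=
  ⟨!![(dir φ).re, -(dir φ).im; (dir φ).im, (dir φ).re], by
    rw [Matrix.det_fin_two_of, neg_mul, sub_neg_eq_add, dir_re_sq_add_im_sq]⟩

theorem planeMap_rotation (φ : AddCircle (2 * Real.pi)) (z : ℂ) :
    planeMap (rotation φ) z = dir φ * z := by
  apply Complex.ext <;> simp [planeMap, rotation] <;> ring

theorem dir_add (φ ψ : AddCircle (2 * Real.pi)) : dir (φ + ψ) = dir φ * dir ψ := by
  simp [dir, AddCircle.toCircle_add]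

theorem continuous_dir : Continuous dir :=
  continuous_subtype_val.comp AddCircle.continuous_toCircle

theorem continuous_rotation : Continuous rotation := by
  have := continuous_dir
  refine continuous_induced_rng.mpr (continuous_matrix fun i j => ?_)
  fin_cases i <;> fin_cases j <;> simp <;> fun_prop

theorem exists_eq_mul_dir {z : ℂ} (hz : z ≠ 0) :
    ∃ (r : ℝ) (α : AddCircle (2 * Real.pi)), r ≠ 0 ∧ z = r * dir α := by
  refine ⟨‖z‖, (z.arg : ℝ), norm_ne_zero_iff.mpr hz, ?_⟩
  rw [dir, AddCircle.toCircle_apply_mk, div_self Real.two_pi_pos.ne', one_mul, Circle.coe_exp,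
    Complex.norm_mul_exp_arg_mul_I]

/-- Some direction is mapped by `g` to a given one. -/
theorem exists_planeMap_dir_eq (g : SL2R) (θ : AddCircle (2 * Real.pi)) :
    ∃ (τ : ℝ) (α : AddCircle (2 * Real.pi)), τ ≠ 0 ∧ planeMap g (dir α) = τ * dir θ := by
  have hne : planeMap g⁻¹ (dir θ) ≠ 0 := by
    intro h
    have := planeMap_apply_inv g (dir θ)
    rw [h, map_zero] at this
    exact Circle.coe_ne_zero _ this.symm
  obtain ⟨r, α, hr, h⟩ := exists_eq_mul_dir hne
  refine ⟨r⁻¹, α, inv_ne_zero hr, ?_⟩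
  rw [← planeMap_apply_inv g (dir θ), h, planeMap_ofReal_mul, ← mul_assoc, ← Complex.ofReal_mul,
    inv_mul_cancel₀ hr, Complex.ofReal_one, one_mul]

/-! ### Null sets of `SL(2, ℝ)` -/

instance : SecondCountableTopology SL2R :=
  have : SecondCountableTopology (Matrix (Fin 2) (Fin 2) ℝ) :=
    inferInstanceAs (SecondCountableTopology (Fin 2 → Fin 2 → ℝ))
  Matrix.SpecialLinearGroup.isClosedEmbedding_val.isEmbedding.secondCountableTopology

/-- A property of cosets which holds almost everywhere for the quotient measure holds for
Haar-almost every element of the group. -/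
theorem ae_haar_of_ae_quotientHaar {Γ : Subgroup SL2R} (hΓ : IsLattice Γ) {Q : SL2R ⧸ Γ → Prop}
    (hQ : ∀ᵐ q ∂quotientHaar hΓ, Q q) : ∀ᵐ g : SL2R ∂Measure.haar, Q g := by
  have hF := hΓ.2.choose_spec
  set F := hΓ.2.choose
  have hmk : Measurable (QuotientGroup.mk : SL2R → SL2R ⧸ Γ) := QuotientGroup.measurable_coe
  have h1 : ∀ᵐ g ∂(ProbabilityTheory.cond Measure.haar F), Q (g : SL2R) :=
    ae_of_ae_map hmk.aemeasurable hQ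
  -- The factor `(haar F)⁻¹` is non-zero because `F` has finite measure.
  rw [ProbabilityTheory.cond, Measure.ae_ennreal_smul_measure_iff (ENNReal.inv_ne_zero.mpr hF.2.ne),
    ae_restrict_iff'₀ hF.1.nullMeasurableSet] at h1
  have := hΓ.1
  have : Countable Γ := TopologicalSpace.separableSpace_iff_countable.mp inferInstance
  have h2 : ∀ᵐ g ∂(Measure.haar : Measure SL2R), ∀ a : Γ,
      g * (a : SL2R) ∈ F → Q ((g * (a : SL2R) : SL2R)) :=
    ae_all_iff.mpr fun a => (quasiMeasurePreserving_mul_right _ (a : SL2R)).ae h1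
  filter_upwards [h2, hF.1.ae_covers] with g hg ⟨a, ha⟩
  have : Q (g * (a : SL2Rᵐᵒᵖ).unop : SL2R) := hg ⟨_, a.2⟩ ha
  rwa [QuotientGroup.mk_mul_of_mem g a.2] at this

theorem ae_haar_of_ae_canonicalMeasure {M : Type u} [TopologicalSpace M]
    {ω₀ : AbelianDifferential M} (hω₀ : ω₀.IsLatticeSurface) {Q : AbelianDifferential M → Prop}
    (hQ : ∀ᵐ x ∂ω₀.canonicalMeasure hω₀, ∀ ω ∈ MulAction.orbit SL2R ω₀, ω.moduliPoint = x → Q ω) :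
    ∀ᵐ g ∂(Measure.haar : Measure SL2R), Q (g • ω₀) := by
  let := ω₀.orbitMeasurableSpace
  have hm : Measurable ω₀.orbitMap := fun _ hs => hs
  have h1 := ae_haar_of_ae_quotientHaar hω₀ (ae_of_ae_map hm.aemeasurable hQ)
  filter_upwards [h1] with g hg
  exact hg _ ⟨g, rfl⟩ rfl

/-- Fubini's theorem: a Haar-null set meets the orbit of some `g` under right rotations in a null
set of angles. -/
theorem exists_ae_mul_rotation {Q : SL2R → Prop} (hQ : ∀ᵐ g ∂(Measure.haar : Measure SL2R), Q g) :
    ∃ g, ∀ᵐ φ : AddCircle (2 * Real.pi), Q (g * rotation φ) := by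
  have hq : Measure.QuasiMeasurePreserving
      (fun x : SL2R × AddCircle (2 * Real.pi) => x.1 * rotation x.2)
      (Measure.haar.prod volume) Measure.haar :=
    QuasiMeasurePreserving.prod_of_left
      (measurable_fst.mul (continuous_rotation.measurable.comp measurable_snd))
      (Eventually.of_forall fun φ => quasiMeasurePreserving_mul_right _ (rotation φ))
  exact (Measure.ae_ae_of_ae_prod (hq.ae hQ)).exists

/-! ### Separation of covering spaces -/

theorem t2Space_of_isCoveringMap {X : Type u} {Y : Type v} [TopologicalSpace X]
    [TopologicalSpace Y] [T2Space X] {p : Y → X} (hp : IsCoveringMap p) : T2Space Y where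
  t2 x y hxy := by
    by_cases h : p x = p y
    · exact hp.isSeparatedMap x y h hxy
    · exact separated_by_continuous hp.continuous h

/-! ### From almost every point of the orbit to almost every direction -/

/-- The transfer principle, for any property of flows invariant under constant time changes. -/
theorem ae_directionalFlow_of_ae_canonicalMeasure {M : Type u} [TopologicalSpace M] [T2Space M]
    {ω₀ : AbelianDifferential M} (hω₀ : ω₀.IsLatticeSurface) {o : H 2 M} {γ : H 1 M}
    {N : Type v} [TopologicalSpace N] [MeasurableSpace N] [BorelSpace N] [AddAction ℤ N]
    {p : N → M} (hp : IsZCover o γ p) (P : FlowSystem N → Prop)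
    (hP : ∀ {S S' : FlowSystem N} {τ : ℝ}, S.IsTimeChange S' τ → τ ≠ 0 → P S' → P S)
    (h : ∀ᵐ x ∂ω₀.canonicalMeasure hω₀, ∀ ω ∈ MulAction.orbit SL2R ω₀, ω.moduliPoint = x →
      P ((hp.lift ω).directionalFlow vertical)) :
    ∀ᵐ θ : AddCircle (2 * Real.pi), P ((hp.lift ω₀).directionalFlow θ) := by
  have := t2Space_of_isCoveringMap hp.isCoveringMap
  obtain ⟨g, hg⟩ := exists_ae_mul_rotation (ae_haar_of_ae_canonicalMeasure hω₀ h)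
  obtain ⟨τ, α, hτ, hα⟩ := exists_planeMap_dir_eq g vertical
  have hmp : MeasurePreserving (fun θ : AddCircle (2 * Real.pi) => α - θ) :=
    volume.measurePreserving_sub_left α
  filter_upwards [hmp.quasiMeasurePreserving.ae hg] with θ hθ
  refine hP ((hp.lift ω₀).directionalFlow_smul_isTimeChange (g := g * rotation (α - θ)) hτ ?_)
    (inv_ne_zero hτ) hθ
  rw [planeMap_mul, planeMap_rotation, ← dir_add, sub_add_cancel, hα]

end FlatSurface

end

theorem proposition8p1 {M : Type*} [TopologicalSpace M] [T2Space M] [CompactSpace M]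
    [ConnectedSpace M] (ω₀ : FlatSurface.AbelianDifferential M) (hω₀ : ω₀.IsLatticeSurface)
    (o : FlatSurface.H 2 M) (ho : FlatSurface.IsFundamentalClass o)
    (γ : FlatSurface.H 1 M) (hγ : γ ≠ 0)
    {N : Type*} [TopologicalSpace N] [MeasurableSpace N] [BorelSpace N] [AddAction ℤ N]
    (p : N → M) (hp : FlatSurface.IsZCover o γ p) :
    ((∀ᵐ x ∂ω₀.canonicalMeasure hω₀,
        ∀ ω ∈ MulAction.orbit FlatSurface.SL2R ω₀, ω.moduliPoint = x →
          ¬ ((hp.lift ω).directionalFlow FlatSurface.AbelianDifferential.vertical).IsErgodic) →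
      ∀ᵐ θ : AddCircle (2 * Real.pi), ¬ ((hp.lift ω₀).directionalFlow θ).IsErgodic) ∧
    ((∀ᵐ x ∂ω₀.canonicalMeasure hω₀,
        ∀ ω ∈ MulAction.orbit FlatSurface.SL2R ω₀, ω.moduliPoint = x →
          ((hp.lift ω).directionalFlow
            FlatSurface.AbelianDifferential.vertical).HasUncountablyManyErgodicComponents) →
      ∀ᵐ θ : AddCircle (2 * Real.pi),
        ((hp.lift ω₀).directionalFlow θ).HasUncountablyManyErgodicComponents) ∧
    ((∀ᵐ x ∂ω₀.canonicalMeasure hω₀,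
        ∀ ω ∈ MulAction.orbit FlatSurface.SL2R ω₀, ω.moduliPoint = x →
          ((hp.lift ω).directionalFlow
            FlatSurface.AbelianDifferential.vertical).HasNoFiniteInvariantSets) →
      ∀ᵐ θ : AddCircle (2 * Real.pi),
        ((hp.lift ω₀).directionalFlow θ).HasNoFiniteInvariantSets) :=
  ⟨FlatSurface.ae_directionalFlow_of_ae_canonicalMeasure hω₀ hp (fun S => ¬ S.IsErgodic)
      fun h hτ => (not_congr (h.isErgodic_iff hτ)).mp,
    FlatSurface.ae_directionalFlow_of_ae_canonicalMeasure hω₀ hp _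
      fun h hτ => (h.hasUncountablyManyErgodicComponents_iff hτ).mp,
    FlatSurface.ae_directionalFlow_of_ae_canonicalMeasure hω₀ hp _
      fun h hτ => (h.hasNoFiniteInvariantSets_iff hτ).mp⟩
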